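/- Let $n\ge 2$. Let $\mathbb R^{n+3}_2$ be $\mathbb R^{n+3}$ with the inner product $\langle\xi,\eta\rangle=-\xi_1\eta_1-\xi_2\eta_2+\sum_{i=3}^{n+3}\xi_i\eta_i$, and let $\mathbb Q^{n+1}_1=\{[\xi]\in\mathbb RP^{n+2}:\langle\xi,\xi\rangle=0\}$ be the conformal space. Let $M$ be a smooth $n$-dimensional manifold and $x:M\to\mathbb Q^{n+1}_1$ a regular space-like hypersurface. That is, $x$ is smooth and, for every smooth local lift $y$ of $x$ to the light cone $\{\xi\neq0:\langle\xi,\xi\rangle=0\}$, the form $\langle dy,dy\rangle$ is positive definite (space-like) and the function $e^{2\tau}=n^2\kappa-\langle\Delta y,\Delta y\rangle$ vanishes nowhere (regular), where $\Delta$ and $\kappa$ are the Laplacian and the normalized scalar curvature of $\langle dy,dy\rangle$. (This function is always non-negative, and $g=e^{2\tau}\langle dy,dy\rangle$, the conformal metric of $x$, does not depend on $y$.) Let $Y=e^{\tau}y$ be the canonical lift, so that $g=\langle dY,dY\rangle$, let $N=-\frac1n\Delta_gY-\frac1{2n^2}\langle\Delta_gY,\Delta_gY\rangle Y$, and let $\xi$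 be a vector field along $x$, unique up to sign, with $\langle\xi,\xi\rangle=-1$ that is orthogonal to $Y$, to $N$ and to all $\partial_iY$. The Blaschke tensor $\mathbb A=\sum A_{ij}\,\omega^i\otimes\omega^j$ and the conformal form $\phi=\sum C_i\,\omega^i$ of $x$ are given by $A_{ij}=\langle\partial_iN,\partial_jY\rangle$ and $C_i=-\langle\partial_iN,\xi\rangle$, i.e. $\partial_iN=\sum_{j,k}A_{ij}g^{jk}\partial_kY+C_i\xi$. If the Blaschke tensor is parallel, that is, $A_{ij,k}=0$ for all $i,j,k$, where the covariant derivative is that of the Levi-Civita connection of $g$, then the conformal form vanishes: $\phi=0$. -/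

import Mathlib

open scoped Manifold ContDiff

noncomputable section

namespace ConformalSpace

/-! ### The pseudo-Euclidean space and the conformal space -/

/-- The inner product of `ℝ^N_s`: minus signs on the first `s` coordinates, plus signs on the
others. -/
def pseudoInner {N : ℕ} (s : ℕ) (ξ η : Fin N → ℝ) : ℝ :=
  ∑ i : Fin N, (if (i : ℕ) < s then -(ξ i * η i) else ξ i * η i)

/-- The conformal space `ℚ^n_s` (projective light cone): the points `[ξ]` of the projective space
of `ℝ^{n+2}_{s+1}` with `⟨ξ, ξ⟩ = 0`. -/
def Quadric (n s : ℕ) : Type :=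
  {P : Projectivization ℝ (Fin (n + 2) → ℝ) // pseudoInner (s + 1) P.rep P.rep = 0}

/-! ### Riemannian geometry in coordinates

`G` is a field of `n × n` matrices on (an open part of) `ℝ^n`: the components of a metric. -/

/-- The coordinates of the manifolds below. -/
abbrev Coord (n : ℕ) : Type := EuclideanSpace ℝ (Fin n)

/-- The partial derivative `∂_i f`. -/
def pd {n : ℕ} {F : Type*} [NormedAddCommGroup F] [NormedSpace ℝ F]
    (i : Fin n) (f : Coord n → F) (p : Coord n) : F :=
  fderiv ℝ f p (EuclideanSpace.single i 1)

/-- The Christoffel symbol `Γ^k_{ij}` of the metric `G`. -/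
def christoffel {n : ℕ} (G : Coord n → Matrix (Fin n) (Fin n) ℝ) (k i j : Fin n)
    (p : Coord n) : ℝ :=
  (1 / 2) * ∑ l : Fin n, (G p)⁻¹ k l *
    (pd i (fun q => G q l j) p + pd j (fun q => G q l i) p - pd l (fun q => G q i j) p)

/-- The Laplacian `Δ f = ∑ G^{ij} (∂_i ∂_j f - ∑ Γ^k_{ij} ∂_k f)` of a vector-valued function. -/
def laplacian {n : ℕ} {F : Type*} [NormedAddCommGroup F] [NormedSpace ℝ F]
    (G : Coord n → Matrix (Fin n) (Fin n) ℝ) (f : Coord n → F) (p : Coord n) : F :=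
  ∑ i : Fin n, ∑ j : Fin n, (G p)⁻¹ i j •
    (pd i (pd j f) p - ∑ k : Fin n, christoffel G k i j p • pd k f p)

/-- The Ricci curvature `R_{jk} = ∑ (∂_i Γ^i_{jk} - ∂_j Γ^i_{ik} + Γ^i_{im} Γ^m_{jk}
- Γ^i_{jm} Γ^m_{ik})`. -/
def ricci {n : ℕ} (G : Coord n → Matrix (Fin n) (Fin n) ℝ) (j k : Fin n) (p : Coord n) : ℝ :=
  ∑ i : Fin n, (pd i (christoffel G i j k) p - pd j (christoffel G i i k) p
    + ∑ m : Fin n, (christoffel G i i m p * christoffel G m j k p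
      - christoffel G i j m p * christoffel G m i k p))

/-- The normalized scalar curvature `κ = (1 / (n (n - 1))) ∑ G^{jk} R_{jk}`. -/
def normalizedScalar {n : ℕ} (G : Coord n → Matrix (Fin n) (Fin n) ℝ) (p : Coord n) : ℝ :=
  (∑ j : Fin n, ∑ k : Fin n, (G p)⁻¹ j k * ricci G j k p) / ((n : ℝ) * ((n : ℝ) - 1))

/-- The covariant derivative `T_{ij,k}` of a `(0,2)`-tensor for the Levi-Civita connection
of `G`. -/
def covDeriv {n : ℕ} (G : Coord n → Matrix (Fin n) (Fin n) ℝ)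
    (T : Fin n → Fin n → Coord n → ℝ) (i j k : Fin n) (p : Coord n) : ℝ :=
  pd k (T i j) p - (∑ l : Fin n, christoffel G l k i p * T l j p)
    - ∑ l : Fin n, christoffel G l k j p * T i l p

/-! ### Conformal invariants of a hypersurface of `ℚ^{n+1}_1`, from a lift in coordinates

`z` is a lift to the light cone of `ℝ^{n+3}_2` of a hypersurface of `ℚ^{n+1}_1`, written in
coordinates. -/

/-- The ambient space `ℝ^{n+3}_2` of the light cone over `ℚ^{n+1}_1`. -/
abbrev Ambient (n : ℕ) : Type := Fin (n + 1 + 2) → ℝ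

/-- The induced metric `⟨dz, dz⟩`. -/
def gram {n : ℕ} (z : Coord n → Ambient n) (p : Coord n) : Matrix (Fin n) (Fin n) ℝ :=
  Matrix.of fun i j => pseudoInner 2 (pd i z p) (pd j z p)

/-- The factor `e^{2τ} = n² κ - ⟨Δz, Δz⟩`, with `Δ` and `κ` those of `⟨dz, dz⟩`. The conformal
metric is `e^{2τ} ⟨dz, dz⟩`; it does not depend on the lift. -/
def factor {n : ℕ} (z : Coord n → Ambient n) (p : Coord n) : ℝ :=
  (n : ℝ) ^ 2 * normalizedScalar (gram z) p
    - pseudoInner 2 (laplacian (gram z) z p) (laplacian (gram z) z p)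

/-- The canonical lift `Y = e^τ z`. Its induced metric `⟨dY, dY⟩` is the conformal metric
`g = e^{2τ} ⟨dz, dz⟩`, because `⟨z, z⟩ = ⟨z, dz⟩ = 0`. -/
def canonicalLift {n : ℕ} (z : Coord n → Ambient n) (p : Coord n) : Ambient n :=
  Real.sqrt (factor z p) • z p

/-- The second null vector `N = - (1/n) ΔY - (1/(2n²)) ⟨ΔY, ΔY⟩ Y` of the conformal frame; it has
`⟨N, N⟩ = 0`, `⟨Y, N⟩ = 1` and `⟨N, dY⟩ = 0`. -/
def nullField {n : ℕ} (Y : Coord n → Ambient n) (p : Coord n) : Ambient n :=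
  (-(1 / (n : ℝ))) • laplacian (gram Y) Y p
    - ((1 / (2 * (n : ℝ) ^ 2)) *
        pseudoInner 2 (laplacian (gram Y) Y p) (laplacian (gram Y) Y p)) • Y p

/-- `ξ` is a unit (time-like) normal vector of the conformal frame at `p`: it is orthogonal to
`Y`, `N` and all `∂_i Y`, and `⟨ξ, ξ⟩ = -1`. It is unique up to sign. -/
structure IsConformalNormal {n : ℕ} (Y : Coord n → Ambient n) (p : Coord n)
    (ξ : Ambient n) : Prop where
  inner_self : pseudoInner 2 ξ ξ = -1
  inner_lift : pseudoInner 2 ξ (Y p) = 0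
  inner_null : pseudoInner 2 ξ (nullField Y p) = 0
  inner_tangent : ∀ i : Fin n, pseudoInner 2 ξ (pd i Y p) = 0

/-- The components `A_{ij} = ⟨∂_i N, ∂_j Y⟩` of the Blaschke tensor, that is, the tangential
coefficients in the structure equation `∂_i N = ∑ A_{ij} g^{jk} ∂_k Y + C_i ξ`. -/
def blaschke {n : ℕ} (Y : Coord n → Ambient n) (i j : Fin n) (p : Coord n) : ℝ :=
  pseudoInner 2 (pd i (nullField Y) p) (pd j Y p)

/-- The components `C_i = -⟨∂_i N, ξ⟩` of the conformal form `φ`, that is, the normal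
coefficients in the structure equation `∂_i N = ∑ A_{ij} g^{jk} ∂_k Y + C_i ξ`
(where `⟨ξ, ξ⟩ = -1`). -/
def conformalForm {n : ℕ} (Y : Coord n → Ambient n) (ξ : Ambient n) (i : Fin n)
    (p : Coord n) : ℝ :=
  -pseudoInner 2 (pd i (nullField Y) p) ξ

/-! ### Hypersurfaces `x : M → ℚ^{n+1}_1` -/

section Hypersurface

variable {n : ℕ} {M : Type*} [TopologicalSpace M] [ChartedSpace (EuclideanSpace ℝ (Fin n)) M]

/-- `y` is a smooth lift of `x` to the light cone over the open set `U`. -/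
structure IsLocalLift (x : M → Quadric (n + 1) 1) (U : Set M) (y : M → Ambient n) : Prop where
  isOpen : IsOpen U
  smooth : ContMDiffOn (𝓡 n) 𝓘(ℝ, Ambient n) ∞ y U
  lifts : ∀ m ∈ U, ∃ h : y m ≠ 0, (x m).1 = Projectivization.mk ℝ (y m) h

/-- `P` holds for the coordinate expression `z = y ∘ e⁻¹` at `e m`, for every local lift `y`
of `x`, every chart `e` of the smooth structure and every point `m` where both are defined. -/
def ForallCoordLift (x : M → Quadric (n + 1) 1)
    (P : (Coord n → Ambient n) → Coord n → Prop) : Prop :=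
  ∀ (U : Set M) (y : M → Ambient n), IsLocalLift x U y →
    ∀ e ∈ IsManifold.maximalAtlas (𝓡 n) ∞ M, ∀ m ∈ U, m ∈ e.source →
      P (fun q => y (e.symm q)) (e m)

/-- Regular space-like hypersurfaces `x : M → ℚ^{n+1}_1`. -/
structure IsRegularSpacelike (x : M → Quadric (n + 1) 1) : Prop where
  /-- `x` is smooth: it has smooth lifts to the light cone near every point. -/
  smooth : ∀ m : M, ∃ (U : Set M) (y : M → Ambient n), m ∈ U ∧ IsLocalLift x U y
  /-- `x` is a space-like immersion: the metric `⟨dy, dy⟩` of a lift, which represents the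
  conformal class induced from `ℚ^{n+1}_1`, is positive definite. -/
  spacelike : ForallCoordLift x fun z p => (gram z p).PosDef
  /-- `x` is regular: the conformal metric `e^{2τ} ⟨dy, dy⟩` is nowhere degenerate. -/
  regular : ForallCoordLift x fun z p => factor z p ≠ 0

/-- The Blaschke tensor of `x` is parallel for the Levi-Civita connection of the conformal
metric: `A_{ij,k} = 0`. -/
def IsBlaschkeParallel (x : M → Quadric (n + 1) 1) : Prop :=
  ForallCoordLift x fun z p => ∀ i j k : Fin n,
    covDeriv (gram (canonicalLift z)) (blaschke (canonicalLift z)) i j k p = 0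

/-- The conformal form `φ` of `x` vanishes (for either choice of the unit normal `ξ`). -/
def ConformalFormVanishes (x : M → Quadric (n + 1) 1) : Prop :=
  ForallCoordLift x fun z p => ∀ ξ : Ambient n, IsConformalNormal (canonicalLift z) p ξ →
    ∀ i : Fin n, conformalForm (canonicalLift z) ξ i p = 0

end Hypersurface

end ConformalSpace

end

/-! Write `B_ij = ⟨hess_ij, ξ⟩` for the second fundamental form of the canonical lift and `C` for
the conformal form. The Codazzi equation `covDeriv_blaschke_sub` says `A_ij,k - A_kj,i = C_i B_kj -
C_k B_ij`, so a parallel Blaschke tensor forces `B_ij C_k = B_kj C_i`. If some `C_k` is nonzero, the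
symmetry of `B` makes it a multiple of `C ⊗ C`; but `B` is trace-free, because `ξ` is orthogonal to
both `N` and `Y`. As `g` is positive definite, `B = 0` (`eq_zero_of_mul_eq_mul`).

This contradicts regularity: by the Gauss equation (`sum_riemann_mul_gram`), `n²κ - ⟨Δz, Δz⟩`
vanishes wherever the second fundamental form does (`factor_eq_zero`). The factor is that of the
given lift `z`, whereas `B` belongs to `Y = e^τ z`; `inner_pd_pd_canonicalLift` passes between them.
All of this is pointwise in `ξ`, so no smooth choice of normal is needed. -/

noncomputable section

namespace ConformalSpace

open Filter Topology

/-! ### The inner product -/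

section Inner

variable {N : ℕ} {s : ℕ}

lemma pseudoInner_eq_sum (ξ η : Fin N → ℝ) :
    pseudoInner s ξ η = ∑ i : Fin N, (if (i : ℕ) < s then (-1 : ℝ) else 1) * (ξ i * η i) := by
  unfold pseudoInner
  refine Finset.sum_congr rfl fun i _ => ?_
  split_ifs <;> ring

lemma pseudoInner_comm (ξ η : Fin N → ℝ) : pseudoInner s ξ η = pseudoInner s η ξ := by
  simp only [pseudoInner, mul_comm]

lemma pseudoInner_add_left (ξ η ζ : Fin N → ℝ) :
    pseudoInner s (ξ + η) ζ = pseudoInner s ξ ζ + pseudoInner s η ζ := by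
  simp only [pseudoInner_eq_sum, ← Finset.sum_add_distrib, Pi.add_apply]
  exact Finset.sum_congr rfl fun i _ => by ring

lemma pseudoInner_smul_left (c : ℝ) (ξ ζ : Fin N → ℝ) :
    pseudoInner s (c • ξ) ζ = c * pseudoInner s ξ ζ := by
  simp only [pseudoInner_eq_sum, Finset.mul_sum, Pi.smul_apply, smul_eq_mul]
  exact Finset.sum_congr rfl fun i _ => by ring

lemma pseudoInner_add_right (ξ η ζ : Fin N → ℝ) :
    pseudoInner s ζ (ξ + η) = pseudoInner s ζ ξ + pseudoInner s ζ η := by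
  simp only [pseudoInner_comm ζ, pseudoInner_add_left]

lemma pseudoInner_smul_right (c : ℝ) (ξ ζ : Fin N → ℝ) :
    pseudoInner s ζ (c • ξ) = c * pseudoInner s ζ ξ := by
  simp only [pseudoInner_comm ζ, pseudoInner_smul_left]

variable (N s) in
/-- The inner product as a bilinear form. -/
def pseudoInnerBilin : (Fin N → ℝ) →ₗ[ℝ] (Fin N → ℝ) →ₗ[ℝ] ℝ :=
  LinearMap.mk₂ ℝ (pseudoInner s) pseudoInner_add_left pseudoInner_smul_left
    (fun ζ ξ η => pseudoInner_add_right ξ η ζ) (fun c ζ ξ => pseudoInner_smul_right c ξ ζ)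

lemma pseudoInnerBilin_apply (ξ η : Fin N → ℝ) :
    pseudoInnerBilin N s ξ η = pseudoInner s ξ η := rfl

lemma pseudoInner_sub_left (ξ η ζ : Fin N → ℝ) :
    pseudoInner s (ξ - η) ζ = pseudoInner s ξ ζ - pseudoInner s η ζ := by
  simp [← pseudoInnerBilin_apply]

lemma pseudoInner_sub_right (ξ η ζ : Fin N → ℝ) :
    pseudoInner s ζ (ξ - η) = pseudoInner s ζ ξ - pseudoInner s ζ η := by
  simp [← pseudoInnerBilin_apply]

@[simp] lemma pseudoInner_zero_left (ζ : Fin N → ℝ) : pseudoInner s 0 ζ = 0 := by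
  simp [← pseudoInnerBilin_apply]

@[simp] lemma pseudoInner_zero_right (ζ : Fin N → ℝ) : pseudoInner s ζ 0 = 0 := by
  simp [← pseudoInnerBilin_apply]

lemma pseudoInner_sum_left {ι : Type*} (t : Finset ι) (f : ι → Fin N → ℝ) (ζ : Fin N → ℝ) :
    pseudoInner s (∑ i ∈ t, f i) ζ = ∑ i ∈ t, pseudoInner s (f i) ζ := by
  simp [← pseudoInnerBilin_apply]

lemma pseudoInner_sum_right {ι : Type*} (t : Finset ι) (f : ι → Fin N → ℝ) (ζ : Fin N → ℝ) :
    pseudoInner s ζ (∑ i ∈ t, f i) = ∑ i ∈ t, pseudoInner s ζ (f i) := by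
  simp [← pseudoInnerBilin_apply]

/-- Nondegeneracy: pairing with the `i`-th unit vector returns `±ξ i`. -/
lemma eq_zero_of_forall_pseudoInner_eq_zero {ξ : Fin N → ℝ}
    (h : ∀ η, pseudoInner s ξ η = 0) : ξ = 0 := by
  funext i
  have := h (Pi.single i 1)
  rw [pseudoInner_eq_sum, Finset.sum_eq_single i (fun j _ hj => by simp [hj]) (by simp)] at this
  simp only [Pi.single_eq_same, mul_one, mul_eq_zero] at this
  refine this.resolve_left ?_
  split_ifs <;> norm_num

end Inner

/-! ### Partial derivatives -/

section PartialDerivatives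

variable {n : ℕ} {F : Type*} [NormedAddCommGroup F] [NormedSpace ℝ F]
  {f g : Coord n → F} {p : Coord n}

lemma _root_.ContDiffAt.pd (hf : ContDiffAt ℝ ∞ f p) (i : Fin n) :
    ContDiffAt ℝ ∞ (pd i f) p :=
  (hf.fderiv_right (m := ∞) (by simp)).clm_apply contDiffAt_const

lemma _root_.ContDiffAt.differentiableAt_infty (hf : ContDiffAt ℝ ∞ f p) :
    DifferentiableAt ℝ f p := hf.differentiableAt (by simp)

lemma pd_congr (h : f =ᶠ[𝓝 p] g) (i : Fin n) : pd i f p = pd i g p := by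
  unfold pd; rw [h.fderiv_eq]

lemma eventuallyEq_pd (h : f =ᶠ[𝓝 p] g) (i : Fin n) : pd i f =ᶠ[𝓝 p] pd i g :=
  h.eventuallyEq_nhds.mono fun _ hq => pd_congr hq i

@[simp] lemma pd_const (c : F) (i : Fin n) : pd i (fun _ : Coord n => c) p = 0 := by
  simp [pd]

lemma pd_add (hf : DifferentiableAt ℝ f p) (hg : DifferentiableAt ℝ g p) (i : Fin n) :
    pd i (fun q => f q + g q) p = pd i f p + pd i g p := by
  unfold pd; rw [fderiv_fun_add hf hg]; rfl

lemma pd_sub (hf : DifferentiableAt ℝ f p) (hg : DifferentiableAt ℝ g p) (i : Fin n) :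
    pd i (fun q => f q - g q) p = pd i f p - pd i g p := by
  unfold pd; rw [fderiv_fun_sub hf hg]; rfl

lemma pd_sum {ι : Type*} (t : Finset ι) {u : ι → Coord n → F}
    (hu : ∀ k ∈ t, DifferentiableAt ℝ (u k) p) (i : Fin n) :
    pd i (fun q => ∑ k ∈ t, u k q) p = ∑ k ∈ t, pd i (u k) p := by
  unfold pd; rw [fderiv_fun_sum hu]; simp

lemma pd_smul {c : Coord n → ℝ} (hc : DifferentiableAt ℝ c p) (hf : DifferentiableAt ℝ f p)
    (i : Fin n) :
    pd i (fun q => c q • f q) p = c p • pd i f p + pd i c p • f p := by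
  unfold pd; rw [fderiv_fun_smul hc hf]; simp

lemma pd_comm (hf : ContDiffAt ℝ ∞ f p) (i j : Fin n) :
    pd i (pd j f) p = pd j (pd i f) p := by
  have hd : DifferentiableAt ℝ (fderiv ℝ f) p :=
    (hf.fderiv_right (m := ∞) (by simp)).differentiableAt_infty
  have key : ∀ a b : Fin n, pd a (pd b f) p =
      fderiv ℝ (fderiv ℝ f) p (EuclideanSpace.single a 1) (EuclideanSpace.single b 1) := by
    intro a b
    unfold pd
    rw [fderiv_clm_apply hd (differentiableAt_const _)]
    simp
  rw [key, key]
  exact (hf.isSymmSndFDerivAt (by simpa using WithTop.coe_le_coe.2 (le_top (a := (2 : ℕ∞))))).eq _ _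

lemma contDiffAt_pseudoInner {N s : ℕ} {u v : Coord n → Fin N → ℝ}
    (hu : ContDiffAt ℝ ∞ u p) (hv : ContDiffAt ℝ ∞ v p) :
    ContDiffAt ℝ ∞ (fun q => pseudoInner s (u q) (v q)) p := by
  simp only [pseudoInner_eq_sum]
  rw [contDiffAt_pi] at hu hv
  exact ContDiffAt.sum fun i _ => contDiffAt_const.mul ((hu i).mul (hv i))

lemma pd_apply {N : ℕ} {u : Coord n → Fin N → ℝ} (hu : DifferentiableAt ℝ u p) (i : Fin n)
    (k : Fin N) : pd i (fun q => u q k) p = pd i u p k := by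
  unfold pd
  rw [fderiv_apply hu]
  rfl

lemma pd_pseudoInner {N s : ℕ} {u v : Coord n → Fin N → ℝ}
    (hu : DifferentiableAt ℝ u p) (hv : DifferentiableAt ℝ v p) (i : Fin n) :
    pd i (fun q => pseudoInner s (u q) (v q)) p =
      pseudoInner s (pd i u p) (v p) + pseudoInner s (u p) (pd i v p) := by
  have hu' := differentiableAt_pi.1 hu
  have hv' := differentiableAt_pi.1 hv
  simp only [pseudoInner_eq_sum]
  rw [pd_sum _ (u := fun (k : Fin N) q => (if (k : ℕ) < s then (-1 : ℝ) else 1) * (u q k * v q k))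
    (fun k _ => ((hu' k).fun_mul (hv' k)).const_mul _), ← Finset.sum_add_distrib]
  refine Finset.sum_congr rfl fun k _ => ?_
  rw [← pd_apply hu, ← pd_apply hv]
  unfold pd
  rw [fderiv_const_mul ((hu' k).fun_mul (hv' k)), fderiv_fun_mul (hu' k) (hv' k)]
  split_ifs <;> simp <;> ring

end PartialDerivatives

/-! ### Smooth matrix fields -/

section MatrixSmooth

variable {E : Type*} [NormedAddCommGroup E] [NormedSpace ℝ E] {n : ℕ}
  {A : E → Matrix (Fin n) (Fin n) ℝ} {p : E}

lemma contDiffAt_det (hA : ∀ i j, ContDiffAt ℝ ∞ (fun q => A q i j) p) :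
    ContDiffAt ℝ ∞ (fun q => (A q).det) p := by
  simp only [Matrix.det_apply, Units.smul_def, zsmul_eq_mul]
  exact ContDiffAt.sum fun σ _ => contDiffAt_const.mul (contDiffAt_prod fun i _ => hA _ _)

lemma contDiffAt_matrix_inv (hA : ∀ i j, ContDiffAt ℝ ∞ (fun q => A q i j) p)
    (hdet : (A p).det ≠ 0) (i j : Fin n) : ContDiffAt ℝ ∞ (fun q => (A q)⁻¹ i j) p := by
  simp only [Matrix.inv_def, Matrix.smul_apply, Matrix.adjugate_apply, smul_eq_mul,
    Ring.inverse_eq_inv']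
  refine ((contDiffAt_det hA).inv hdet).mul (contDiffAt_det fun a b => ?_)
  -- The adjugate entry is the determinant of `A q` with row `j` replaced by a constant unit vector.
  by_cases h : a = j
  · subst h; simpa using contDiffAt_const
  · simpa [Matrix.updateRow_ne h] using hA a b

end MatrixSmooth

variable {n : ℕ}

/-! ### Immersions into the light cone -/

/-- `z` is a smooth map from the open set `Ω` to the light cone with nondegenerate induced
metric. -/
structure IsNullImmersion (z : Coord n → Ambient n) (Ω : Set (Coord n)) : Prop where
  isOpen : IsOpen Ω
  smooth : ∀ q ∈ Ω, ContDiffAt ℝ ∞ z q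
  null : ∀ q ∈ Ω, pseudoInner 2 (z q) (z q) = 0
  det_ne_zero : ∀ q ∈ Ω, (gram z q).det ≠ 0

/-- The covariant Hessian `∂_i ∂_j z - ∑ Γ^k_{ij} ∂_k z`. -/
def hess (z : Coord n → Ambient n) (i j : Fin n) (p : Coord n) : Ambient n :=
  pd i (pd j z) p - ∑ k : Fin n, christoffel (gram z) k i j p • pd k z p

lemma laplacian_eq_sum_hess (z : Coord n → Ambient n) (p : Coord n) :
    laplacian (gram z) z p = ∑ i : Fin n, ∑ j : Fin n, (gram z p)⁻¹ i j • hess z i j p := rfl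

lemma gram_apply (z : Coord n → Ambient n) (p : Coord n) (i j : Fin n) :
    gram z p i j = pseudoInner 2 (pd i z p) (pd j z p) := rfl

lemma gram_symm (z : Coord n → Ambient n) (p : Coord n) (i j : Fin n) :
    gram z p i j = gram z p j i := pseudoInner_comm _ _

lemma gram_transpose (z : Coord n → Ambient n) (p : Coord n) :
    (gram z p).transpose = gram z p := by
  ext i j; exact gram_symm z p j i

lemma gram_inv_symm (z : Coord n → Ambient n) (p : Coord n) (i j : Fin n) :
    (gram z p)⁻¹ i j = (gram z p)⁻¹ j i := by
  conv_lhs => rw [← gram_transpose, ← Matrix.transpose_nonsing_inv, Matrix.transpose_apply]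

namespace IsNullImmersion

variable {z : Coord n → Ambient n} {Ω : Set (Coord n)} {p : Coord n}

lemma contDiffAt_gram (h : IsNullImmersion z Ω) (hp : p ∈ Ω) (i j : Fin n) :
    ContDiffAt ℝ ∞ (fun q => gram z q i j) p :=
  contDiffAt_pseudoInner ((h.smooth p hp).pd i) ((h.smooth p hp).pd j)

lemma contDiffAt_gram_inv (h : IsNullImmersion z Ω) (hp : p ∈ Ω) (i j : Fin n) :
    ContDiffAt ℝ ∞ (fun q => (gram z q)⁻¹ i j) p :=
  contDiffAt_matrix_inv (h.contDiffAt_gram hp) (h.det_ne_zero p hp) i j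

lemma contDiffAt_christoffel (h : IsNullImmersion z Ω) (hp : p ∈ Ω) (k i j : Fin n) :
    ContDiffAt ℝ ∞ (christoffel (gram z) k i j) p := by
  unfold christoffel
  exact contDiffAt_const.mul (ContDiffAt.sum fun l _ => (h.contDiffAt_gram_inv hp k l).mul
    ((((h.contDiffAt_gram hp l j).pd i).add ((h.contDiffAt_gram hp l i).pd j)).sub
      ((h.contDiffAt_gram hp i j).pd l)))

lemma contDiffAt_hess (h : IsNullImmersion z Ω) (hp : p ∈ Ω) (i j : Fin n) :
    ContDiffAt ℝ ∞ (hess z i j) p := by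
  unfold hess
  exact (((h.smooth p hp).pd j).pd i).sub (ContDiffAt.sum fun k _ =>
    (h.contDiffAt_christoffel hp k i j).smul ((h.smooth p hp).pd k))

lemma contDiffAt_laplacian (h : IsNullImmersion z Ω) (hp : p ∈ Ω) :
    ContDiffAt ℝ ∞ (laplacian (gram z) z) p := by
  unfold laplacian
  exact ContDiffAt.sum fun i _ => ContDiffAt.sum fun j _ =>
    (h.contDiffAt_gram_inv hp i j).smul (h.contDiffAt_hess hp i j)

lemma contDiffAt_nullField (h : IsNullImmersion z Ω) (hp : p ∈ Ω) :
    ContDiffAt ℝ ∞ (nullField z) p := by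
  unfold nullField
  exact ((h.contDiffAt_laplacian hp).const_smul _).sub
    ((contDiffAt_const.mul (contDiffAt_pseudoInner (h.contDiffAt_laplacian hp)
      (h.contDiffAt_laplacian hp))).smul (h.smooth p hp))

lemma contDiffAt_ricci (h : IsNullImmersion z Ω) (hp : p ∈ Ω) (j k : Fin n) :
    ContDiffAt ℝ ∞ (ricci (gram z) j k) p := by
  unfold ricci
  have hΓ := h.contDiffAt_christoffel hp
  exact ContDiffAt.sum fun i _ => (((hΓ _ _ _).pd _).sub ((hΓ _ _ _).pd _)).add
    (ContDiffAt.sum fun m _ => ((hΓ _ _ _).mul (hΓ _ _ _)).sub ((hΓ _ _ _).mul (hΓ _ _ _)))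

lemma contDiffAt_factor (h : IsNullImmersion z Ω) (hp : p ∈ Ω) :
    ContDiffAt ℝ ∞ (factor z) p := by
  unfold factor normalizedScalar
  exact (contDiffAt_const.mul ((ContDiffAt.sum fun j _ => ContDiffAt.sum fun k _ =>
    (h.contDiffAt_gram_inv hp j k).mul (h.contDiffAt_ricci hp j k)).div_const _)).sub
    (contDiffAt_pseudoInner (h.contDiffAt_laplacian hp) (h.contDiffAt_laplacian hp))

lemma sum_gram_inv_mul (h : IsNullImmersion z Ω) (hp : p ∈ Ω) (i j : Fin n) :
    ∑ k : Fin n, (gram z p)⁻¹ i k * gram z p k j = if i = j then 1 else 0 := by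
  rw [← Matrix.mul_apply, Matrix.nonsing_inv_mul _ (h.det_ne_zero p hp).isUnit, Matrix.one_apply]

/-- Contraction of a covector with the inverse metric and then with the metric. -/
lemma sum_gram_inv_mul_mul_gram (h : IsNullImmersion z Ω) (hp : p ∈ Ω) (a : Fin n → ℝ)
    (m : Fin n) :
    ∑ k : Fin n, (∑ l : Fin n, (gram z p)⁻¹ k l * a l) * gram z p k m = a m := by
  calc ∑ k : Fin n, (∑ l : Fin n, (gram z p)⁻¹ k l * a l) * gram z p k m
      = ∑ l : Fin n, a l * ∑ k : Fin n, (gram z p)⁻¹ l k * gram z p k m := by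
        simp only [Finset.sum_mul, Finset.mul_sum]
        rw [Finset.sum_comm]
        refine Finset.sum_congr rfl fun l _ => Finset.sum_congr rfl fun k _ => ?_
        rw [gram_inv_symm z p k l]; ring
    _ = a m := by simp [h.sum_gram_inv_mul hp]

lemma sum_gram_inv_mul_gram (h : IsNullImmersion z Ω) (hp : p ∈ Ω) :
    ∑ i : Fin n, ∑ j : Fin n, (gram z p)⁻¹ i j * gram z p i j = n := by
  have key : ∀ i, ∑ j : Fin n, (gram z p)⁻¹ i j * gram z p i j = 1 := fun i =>
    (Finset.sum_congr rfl fun j _ => by rw [gram_symm z p i j]).trans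
      ((h.sum_gram_inv_mul hp i i).trans (if_pos rfl))
  rw [Finset.sum_congr rfl fun i _ => key i]
  simp

/-- Differentiation of a function that is constant on `Ω`. -/
lemma pd_eq_zero_of_eq_const (h : IsNullImmersion z Ω) (hp : p ∈ Ω) {f : Coord n → ℝ} {c : ℝ}
    (hf : ∀ q ∈ Ω, f q = c) (i : Fin n) : pd i f p = 0 := by
  rw [pd_congr (g := fun _ => c) (eventually_of_mem (h.isOpen.mem_nhds hp) hf), pd_const]

/-! ### Inner products of the lift, its Hessian, its Laplacian and `N` -/

lemma inner_pd (h : IsNullImmersion z Ω) (hp : p ∈ Ω) (i : Fin n) :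
    pseudoInner 2 (pd i z p) (z p) = 0 := by
  have h1 := h.pd_eq_zero_of_eq_const hp h.null i
  have hd := (h.smooth p hp).differentiableAt_infty
  rw [pd_pseudoInner hd hd, pseudoInner_comm (z p)] at h1
  linarith

lemma inner_pd_pd (h : IsNullImmersion z Ω) (hp : p ∈ Ω) (i j : Fin n) :
    pseudoInner 2 (pd i (pd j z) p) (z p) = -gram z p i j := by
  have h1 := h.pd_eq_zero_of_eq_const hp (fun q hq => h.inner_pd hq j) i
  rw [pd_pseudoInner ((h.smooth p hp).pd j).differentiableAt_infty
    (h.smooth p hp).differentiableAt_infty] at h1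
  rw [gram_symm, gram_apply]
  linarith

/-- Expanding the three derivatives of the induced metric gives six terms; symmetry of second
derivatives cancels four and doubles the other. The Christoffel symbols are thus the tangential
coefficients of `∂_i ∂_j z`. -/
lemma christoffel_eq (h : IsNullImmersion z Ω) (hp : p ∈ Ω) (k i j : Fin n) :
    christoffel (gram z) k i j p =
      ∑ l : Fin n, (gram z p)⁻¹ k l * pseudoInner 2 (pd i (pd j z) p) (pd l z p) := by
  have hs := h.smooth p hp
  have hd : ∀ a, DifferentiableAt ℝ (pd a z) p := fun a => (hs.pd a).differentiableAt_infty
  unfold christoffel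
  rw [Finset.mul_sum]
  refine Finset.sum_congr rfl fun l _ => ?_
  simp only [gram_apply]
  rw [pd_pseudoInner (hd l) (hd j), pd_pseudoInner (hd l) (hd i), pd_pseudoInner (hd i) (hd j),
    pd_comm hs i l, pd_comm hs j l, pd_comm hs j i, pseudoInner_comm (pd l z p),
    pseudoInner_comm (pd i z p)]
  ring

lemma christoffel_symm (h : IsNullImmersion z Ω) (hp : p ∈ Ω) (k i j : Fin n) :
    christoffel (gram z) k i j p = christoffel (gram z) k j i p := by
  rw [h.christoffel_eq hp, h.christoffel_eq hp, pd_comm (h.smooth p hp)]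

lemma hess_symm (h : IsNullImmersion z Ω) (hp : p ∈ Ω) (i j : Fin n) :
    hess z i j p = hess z j i p := by
  simp only [hess, h.christoffel_symm hp _ i j, pd_comm (h.smooth p hp) i j]

lemma inner_hess_of_orthogonal {ζ : Ambient n} (hζ : ∀ i, pseudoInner 2 (pd i z p) ζ = 0)
    (i j : Fin n) : pseudoInner 2 (hess z i j p) ζ = pseudoInner 2 (pd i (pd j z) p) ζ := by
  simp [hess, pseudoInner_sub_left, pseudoInner_sum_left, pseudoInner_smul_left, hζ]

lemma inner_hess_lift (h : IsNullImmersion z Ω) (hp : p ∈ Ω) (i j : Fin n) :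
    pseudoInner 2 (hess z i j p) (z p) = -gram z p i j := by
  rw [inner_hess_of_orthogonal (h.inner_pd hp), h.inner_pd_pd hp]

/-- Gauss formula: by `christoffel_eq`, subtracting the Christoffel terms removes exactly the
tangential part. -/
lemma inner_hess_pd (h : IsNullImmersion z Ω) (hp : p ∈ Ω) (i j l : Fin n) :
    pseudoInner 2 (hess z i j p) (pd l z p) = 0 := by
  simp only [hess, pseudoInner_sub_left, pseudoInner_sum_left, pseudoInner_smul_left,
    h.christoffel_eq hp, ← gram_apply]
  rw [h.sum_gram_inv_mul_mul_gram hp (fun l => pseudoInner 2 (pd i (pd j z) p) (pd l z p)), sub_self]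

lemma inner_laplacian (ζ : Ambient n) :
    pseudoInner 2 (laplacian (gram z) z p) ζ =
      ∑ i : Fin n, ∑ j : Fin n, (gram z p)⁻¹ i j * pseudoInner 2 (hess z i j p) ζ := by
  simp only [laplacian_eq_sum_hess, pseudoInner_sum_left, pseudoInner_smul_left]

lemma inner_laplacian_lift (h : IsNullImmersion z Ω) (hp : p ∈ Ω) :
    pseudoInner 2 (laplacian (gram z) z p) (z p) = -n := by
  simp [inner_laplacian, h.inner_hess_lift hp, h.sum_gram_inv_mul_gram hp]

lemma inner_laplacian_pd (h : IsNullImmersion z Ω) (hp : p ∈ Ω) (l : Fin n) :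
    pseudoInner 2 (laplacian (gram z) z p) (pd l z p) = 0 := by
  simp [inner_laplacian, h.inner_hess_pd hp]

lemma inner_nullField (ζ : Ambient n) :
    pseudoInner 2 (nullField z p) ζ = -(1 / (n : ℝ)) * pseudoInner 2 (laplacian (gram z) z p) ζ
      - ((1 / (2 * (n : ℝ) ^ 2)) * pseudoInner 2 (laplacian (gram z) z p)
        (laplacian (gram z) z p)) * pseudoInner 2 (z p) ζ := by
  simp only [nullField, pseudoInner_sub_left, pseudoInner_smul_left]

lemma inner_nullField_lift (h : IsNullImmersion z Ω) (hn : n ≠ 0) (hp : p ∈ Ω) :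
    pseudoInner 2 (nullField z p) (z p) = 1 := by
  have : (n : ℝ) ≠ 0 := by exact_mod_cast hn
  rw [inner_nullField, h.inner_laplacian_lift hp, h.null p hp]
  field_simp
  ring

lemma inner_nullField_pd (h : IsNullImmersion z Ω) (hp : p ∈ Ω) (l : Fin n) :
    pseudoInner 2 (nullField z p) (pd l z p) = 0 := by
  rw [inner_nullField, h.inner_laplacian_pd hp, pseudoInner_comm (z p), h.inner_pd hp]
  ring

/-- The coefficient of `z` in `N` is tuned for this: as `⟨Δz, z⟩ = -n`, the cross term cancels `⟨Δz,
Δz⟩ / n²`. -/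
lemma inner_nullField_self (h : IsNullImmersion z Ω) (hn : n ≠ 0) (hp : p ∈ Ω) :
    pseudoInner 2 (nullField z p) (nullField z p) = 0 := by
  have : (n : ℝ) ≠ 0 := by exact_mod_cast hn
  rw [inner_nullField, pseudoInner_comm (z p), h.inner_nullField_lift hn hp, pseudoInner_comm,
    inner_nullField, pseudoInner_comm (z p), h.inner_laplacian_lift hp]
  field_simp
  ring

/-! #### The conformal frame -/

/-- The frame `z, N, ∂_i z, ξ` spans the ambient space. -/
lemma eq_zero_of_orthogonal_frame (h : IsNullImmersion z Ω) (hn : n ≠ 0) (hp : p ∈ Ω)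
    {ξ : Ambient n} (hξ : IsConformalNormal z p ξ) {w : Ambient n}
    (h1 : pseudoInner 2 w (z p) = 0) (h2 : pseudoInner 2 w (nullField z p) = 0)
    (h3 : pseudoInner 2 w ξ = 0) (h4 : ∀ i, pseudoInner 2 w (pd i z p) = 0) : w = 0 := by
  let b : Fin n ⊕ Fin 3 → Ambient n :=
    Sum.elim (fun i => pd i z p) ![z p, nullField z p, ξ]
  -- Since `⟨z, N⟩ = 1` and both are null, pairing a linear relation with `z`, `N`, `ξ` isolates the
  -- coefficients of `N`, `z`, `ξ` respectively. The tangential ones then vanish because the Gram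
  -- matrix is invertible.
  have hli : LinearIndependent ℝ b := by
    rw [Fintype.linearIndependent_iff]
    intro c hc
    have inner : ∀ ζ, ∑ i, c (Sum.inl i) * pseudoInner 2 (pd i z p) ζ
        + (c (Sum.inr 0) * pseudoInner 2 (z p) ζ
          + c (Sum.inr 1) * pseudoInner 2 (nullField z p) ζ
          + c (Sum.inr 2) * pseudoInner 2 ξ ζ) = 0 := by
      intro ζ
      have := congrArg (fun v => pseudoInner 2 v ζ) hc
      simpa [b, Fin.sum_univ_three, pseudoInner_add_left, pseudoInner_smul_left,
        pseudoInner_sum_left] using this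
    have e0 := inner (z p)
    have e1 := inner (nullField z p)
    have e2 := inner ξ
    have hNz := h.inner_nullField_lift hn hp
    have hpN : ∀ i, pseudoInner 2 (pd i z p) (nullField z p) = 0 := fun i => by
      rw [pseudoInner_comm, h.inner_nullField_pd hp]
    simp only [h.inner_pd hp, h.null p hp, hNz, hξ.inner_lift] at e0
    simp only [hpN, pseudoInner_comm (z p), hNz, h.inner_nullField_self hn hp,
      hξ.inner_null] at e1
    simp only [pseudoInner_comm _ ξ, hξ.inner_self, hξ.inner_lift, hξ.inner_null,
      hξ.inner_tangent] at e2
    simp only [mul_zero, Finset.sum_const_zero, zero_add, add_zero, mul_one, mul_neg] at e0 e1 e2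
    have e3 : ∀ m, ∑ i, c (Sum.inl i) * gram z p i m = 0 := by
      intro m
      have := inner (pd m z p)
      rw [e0, e1, neg_eq_zero.1 e2] at this
      simpa [gram_apply] using this
    have e4 : Matrix.vecMul (fun i => c (Sum.inl i)) (gram z p) = 0 := by
      ext m; simpa [Matrix.vecMul, dotProduct] using e3 m
    have e5 := Matrix.eq_zero_of_vecMul_eq_zero (h.det_ne_zero p hp) e4
    rintro (i | i)
    · exact congrFun e5 i
    · fin_cases i
      exacts [e1, e0, neg_eq_zero.1 e2]
  -- There are `n + 3` vectors, the dimension of the ambient space.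
  have hspan : Submodule.span ℝ (Set.range b) = ⊤ :=
    hli.span_eq_top_of_card_eq_finrank' (by simp)
  have hle : Submodule.span ℝ (Set.range b) ≤ LinearMap.ker (pseudoInnerBilin _ 2 w) := by
    rw [Submodule.span_le]
    rintro _ ⟨i | i, rfl⟩
    · exact h4 i
    · fin_cases i
      exacts [h1, h2, h3]
  refine eq_zero_of_forall_pseudoInner_eq_zero (s := 2) fun η => ?_
  have : η ∈ Submodule.span ℝ (Set.range b) := hspan ▸ Submodule.mem_top
  exact hle this

/-- Expansion of a vector orthogonal to the immersion in the conformal frame. -/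
lemma eq_frame_of_orthogonal (h : IsNullImmersion z Ω) (hn : n ≠ 0) (hp : p ∈ Ω)
    {ξ : Ambient n} (hξ : IsConformalNormal z p ξ) {v : Ambient n}
    (hv : ∀ i, pseudoInner 2 v (pd i z p) = 0) :
    v = pseudoInner 2 v (nullField z p) • z p + pseudoInner 2 v (z p) • nullField z p
      - pseudoInner 2 v ξ • ξ := by
  rw [← sub_eq_zero]
  have hNz := h.inner_nullField_lift hn hp
  apply h.eq_zero_of_orthogonal_frame hn hp hξ <;>
    simp only [pseudoInner_add_left, pseudoInner_sub_left, pseudoInner_smul_left]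
  · rw [h.null p hp, hNz, hξ.inner_lift]; ring
  · rw [pseudoInner_comm (z p), hNz, h.inner_nullField_self hn hp, hξ.inner_null]; ring
  · rw [pseudoInner_comm (z p), hξ.inner_lift, pseudoInner_comm (nullField z p) ξ, hξ.inner_null,
      hξ.inner_self]; ring
  · intro i
    rw [hv, pseudoInner_comm (z p), h.inner_pd hp, h.inner_nullField_pd hp, hξ.inner_tangent]; ring

end IsNullImmersion

/-- The curvature tensor `R^a_{ijk}` whose contraction is `ricci`. -/
def riemann (G : Coord n → Matrix (Fin n) (Fin n) ℝ) (a i j k : Fin n) (p : Coord n) : ℝ :=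
  pd i (christoffel G a j k) p - pd j (christoffel G a i k) p
    + ∑ m : Fin n, (christoffel G a i m p * christoffel G m j k p
      - christoffel G a j m p * christoffel G m i k p)

lemma ricci_eq_sum_riemann (G : Coord n → Matrix (Fin n) (Fin n) ℝ) (j k : Fin n)
    (p : Coord n) : ricci G j k p = ∑ i : Fin n, riemann G i i j k p := rfl

/-! ### The Gauss equation and its traces -/

namespace IsNullImmersion

variable {z : Coord n → Ambient n} {Ω : Set (Coord n)} {p : Coord n}

lemma inner_hess_hess (h : IsNullImmersion z Ω) (hp : p ∈ Ω) (i j k l : Fin n) :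
    pseudoInner 2 (hess z i j p) (hess z k l p) =
      pseudoInner 2 (hess z i j p) (pd k (pd l z) p) := by
  rw [pseudoInner_comm, inner_hess_of_orthogonal (fun m => ?_), pseudoInner_comm]
  rw [pseudoInner_comm, h.inner_hess_pd hp]

/-- Differentiate `⟨hess_jk, ∂_l z⟩ = 0`; `∂_i ∂_l z` may be replaced by `hess_il`, the difference
being tangential. -/
lemma inner_pd_hess_pd (h : IsNullImmersion z Ω) (hp : p ∈ Ω) (i j k l : Fin n) :
    pseudoInner 2 (pd i (hess z j k) p) (pd l z p) =
      -pseudoInner 2 (hess z j k p) (hess z i l p) := by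
  have h1 := h.pd_eq_zero_of_eq_const hp (fun q hq => h.inner_hess_pd hq j k l) i
  rw [pd_pseudoInner (h.contDiffAt_hess hp j k).differentiableAt_infty
    ((h.smooth p hp).pd l).differentiableAt_infty] at h1
  rw [h.inner_hess_hess hp]
  linarith

lemma inner_pd_pd_pd (h : IsNullImmersion z Ω) (hp : p ∈ Ω) (i j l : Fin n) :
    pseudoInner 2 (pd i (pd j z) p) (pd l z p) =
      ∑ a : Fin n, christoffel (gram z) a i j p * gram z p a l := by
  have := h.inner_hess_pd hp i j l
  simp only [hess, pseudoInner_sub_left, pseudoInner_sum_left, pseudoInner_smul_left,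
    ← gram_apply] at this
  linarith

lemma pd_hess (h : IsNullImmersion z Ω) (hp : p ∈ Ω) (i j k : Fin n) :
    pd i (hess z j k) p = pd i (pd j (pd k z)) p
      - ∑ m : Fin n, (christoffel (gram z) m j k p • pd i (pd m z) p
        + pd i (christoffel (gram z) m j k) p • pd m z p) := by
  have hs := h.smooth p hp
  have hterm : ∀ m, ContDiffAt ℝ ∞ (fun q => christoffel (gram z) m j k q • pd m z q) p :=
    fun m => (h.contDiffAt_christoffel hp m j k).smul (hs.pd m)
  unfold hess
  rw [pd_sub ((hs.pd k).pd j).differentiableAt_infty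
    (ContDiffAt.sum fun m _ => hterm m).differentiableAt_infty,
    pd_sum _ fun m _ => (hterm m).differentiableAt_infty]
  congr 1
  exact Finset.sum_congr rfl fun m _ => pd_smul
    (h.contDiffAt_christoffel hp m j k).differentiableAt_infty
    (hs.pd m).differentiableAt_infty i

/-- The Gauss equation. -/
lemma sum_riemann_mul_gram (h : IsNullImmersion z Ω) (hp : p ∈ Ω) (i j k l : Fin n) :
    ∑ a : Fin n, riemann (gram z) a i j k p * gram z p a l =
      pseudoInner 2 (hess z j k p) (hess z i l p)
        - pseudoInner 2 (hess z i k p) (hess z j l p) := by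
  -- Antisymmetrizing this in `i`, `j` cancels the third derivatives of `z` and leaves the curvature
  -- tensor.
  have expand : ∀ i j : Fin n, pseudoInner 2 (pd i (hess z j k) p) (pd l z p) =
      pseudoInner 2 (pd i (pd j (pd k z)) p) (pd l z p)
        - ∑ a : Fin n, (∑ m : Fin n, christoffel (gram z) a i m p * christoffel (gram z) m j k p
          + pd i (christoffel (gram z) a j k) p) * gram z p a l := by
    intro i j
    rw [h.pd_hess hp, pseudoInner_sub_left, pseudoInner_sum_left]
    simp only [pseudoInner_add_left, pseudoInner_smul_left, h.inner_pd_pd_pd hp i, ← gram_apply,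
      add_mul, Finset.sum_add_distrib, Finset.mul_sum, Finset.sum_mul]
    congr 2
    rw [Finset.sum_comm]
    exact Finset.sum_congr rfl fun _ _ => Finset.sum_congr rfl fun _ _ => by ring
  have e1 := expand i j
  have e2 := expand j i
  rw [h.inner_pd_hess_pd hp] at e1 e2
  rw [pd_comm ((h.smooth p hp).pd k) i j] at e1
  have e3 : ∑ a : Fin n, riemann (gram z) a i j k p * gram z p a l =
      ∑ a : Fin n, (∑ m : Fin n, christoffel (gram z) a i m p * christoffel (gram z) m j k p
          + pd i (christoffel (gram z) a j k) p) * gram z p a l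
      - ∑ a : Fin n, (∑ m : Fin n, christoffel (gram z) a j m p * christoffel (gram z) m i k p
          + pd j (christoffel (gram z) a i k) p) * gram z p a l := by
    rw [← Finset.sum_sub_distrib]
    refine Finset.sum_congr rfl fun a _ => ?_
    rw [riemann, Finset.sum_sub_distrib]
    ring
  rw [e3]
  linarith

lemma ricci_eq (h : IsNullImmersion z Ω) (hp : p ∈ Ω) (j k : Fin n) :
    ricci (gram z) j k p = ∑ i : Fin n, ∑ l : Fin n, (gram z p)⁻¹ i l *
      (pseudoInner 2 (hess z j k p) (hess z i l p)
        - pseudoInner 2 (hess z i k p) (hess z j l p)) := by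
  rw [ricci_eq_sum_riemann]
  refine Finset.sum_congr rfl fun i _ => ?_
  simp only [← h.sum_riemann_mul_gram hp i j k, Finset.mul_sum]
  rw [Finset.sum_comm]
  have : ∀ a, ∑ l : Fin n, (gram z p)⁻¹ i l * (riemann (gram z) a i j k p * gram z p a l)
      = riemann (gram z) a i j k p * if i = a then 1 else 0 := by
    intro a
    rw [← h.sum_gram_inv_mul hp i a, Finset.mul_sum]
    exact Finset.sum_congr rfl fun l _ => by rw [gram_symm z p a l]; ring
  simp [this]

/-- A conformal metric degenerates where the second fundamental form vanishes. -/
lemma factor_eq_zero (h : IsNullImmersion z Ω) (hn : 2 ≤ n) (hp : p ∈ Ω) {ξ : Ambient n}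
    (hξξ : pseudoInner 2 ξ ξ = -1) (hξz : pseudoInner 2 ξ (z p) = 0)
    (hξt : ∀ i, pseudoInner 2 ξ (pd i z p) = 0)
    (hB : ∀ i j, pseudoInner 2 (pd i (pd j z) p) ξ = 0) : factor z p = 0 := by
  have hn0 : n ≠ 0 := by omega
  have hBh : ∀ i j, pseudoInner 2 (hess z i j p) ξ = 0 := fun i j => by
    rw [inner_hess_of_orthogonal (fun m => by rw [pseudoInner_comm, hξt]), hB]
  -- With no second fundamental form, `Δz` and hence `N` are orthogonal to `ξ`.
  have hξ : IsConformalNormal z p ξ := by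
    refine ⟨hξξ, hξz, ?_, hξt⟩
    rw [pseudoInner_comm, inner_nullField, pseudoInner_comm (z p), hξz, inner_laplacian]
    simp [hBh]
  obtain ⟨a, ha⟩ : ∃ a : Fin n → Fin n → ℝ,
      ∀ i j, pseudoInner 2 (hess z i j p) (nullField z p) = a i j := ⟨_, fun _ _ => rfl⟩
  -- The frame expansion reduces to `hess_ij = a_ij z - g_ij N`, so all curvature is expressed by
  -- `a` and `g`.
  have hinner : ∀ i j k l, pseudoInner 2 (hess z i j p) (hess z k l p) =
      -(a i j * gram z p k l) - gram z p i j * a k l := by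
    intro i j k l
    have := h.eq_frame_of_orthogonal hn0 hp hξ (h.inner_hess_pd hp i j)
    rw [hBh, h.inner_hess_lift hp, ha] at this
    rw [this, zero_smul, sub_zero, pseudoInner_add_left, pseudoInner_smul_left,
      pseudoInner_smul_left, pseudoInner_comm (z p), pseudoInner_comm (nullField z p),
      h.inner_hess_lift hp, ha]
    ring
  obtain ⟨t, ht⟩ : ∃ t : ℝ, ∑ i : Fin n, ∑ j : Fin n, (gram z p)⁻¹ i j * a i j = t := ⟨_, rfl⟩
  have hgg := h.sum_gram_inv_mul_gram hp
  have hdouble : ∀ α β : ℝ, ∑ j : Fin n, ∑ k : Fin n, (gram z p)⁻¹ j k *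
      (α * a j k + β * gram z p j k) = α * t + β * n := by
    intro α β
    rw [← ht, ← hgg]
    simp only [Finset.mul_sum, ← Finset.sum_add_distrib]
    exact Finset.sum_congr rfl fun _ _ => Finset.sum_congr rfl fun _ _ => by ring
  have htrace : ∀ j k, ∑ i : Fin n, ∑ l : Fin n, (gram z p)⁻¹ i l *
      pseudoInner 2 (hess z j k p) (hess z i l p) = -(n * a j k) - gram z p j k * t := by
    intro j k
    have e : ∀ i l, pseudoInner 2 (hess z j k p) (hess z i l p) =
        -gram z p j k * a i l + -a j k * gram z p i l := fun i l => by rw [hinner]; ring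
    simp only [e, hdouble]
    ring
  have hcross : ∀ j k, ∑ i : Fin n, ∑ l : Fin n, (gram z p)⁻¹ i l *
      pseudoInner 2 (hess z i k p) (hess z j l p) = -(2 * a j k) := by
    intro j k
    have c1 : ∀ i, ∑ l : Fin n, (gram z p)⁻¹ i l * gram z p j l = if i = j then 1 else 0 :=
      fun i => by
        rw [← h.sum_gram_inv_mul hp i j]
        exact Finset.sum_congr rfl fun l _ => by rw [gram_symm]
    have c2 : ∀ l, ∑ i : Fin n, (gram z p)⁻¹ i l * gram z p i k = if l = k then 1 else 0 :=
      fun l => by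
        rw [← h.sum_gram_inv_mul hp l k]
        exact Finset.sum_congr rfl fun i _ => by rw [gram_inv_symm]
    have d1 : ∑ i : Fin n, ∑ l : Fin n, (gram z p)⁻¹ i l * (a i k * gram z p j l) = a j k := by
      calc _ = ∑ i : Fin n, a i k * ∑ l : Fin n, (gram z p)⁻¹ i l * gram z p j l := by
            simp only [Finset.mul_sum]
            exact Finset.sum_congr rfl fun _ _ => Finset.sum_congr rfl fun _ _ => by ring
        _ = a j k := by simp [c1]
    have d2 : ∑ i : Fin n, ∑ l : Fin n, (gram z p)⁻¹ i l * (gram z p i k * a j l) = a j k := by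
      calc _ = ∑ l : Fin n, a j l * ∑ i : Fin n, (gram z p)⁻¹ i l * gram z p i k := by
            rw [Finset.sum_comm]
            simp only [Finset.mul_sum]
            exact Finset.sum_congr rfl fun _ _ => Finset.sum_congr rfl fun _ _ => by ring
        _ = a j k := by simp [c2]
    simp only [hinner, mul_sub, mul_neg, Finset.sum_sub_distrib, Finset.sum_neg_distrib]
    rw [d1, d2]; ring
  have hΔ : pseudoInner 2 (laplacian (gram z) z p) (laplacian (gram z) z p) =
      -(2 * n * t) := by
    have e : ∀ j k, pseudoInner 2 (hess z j k p) (laplacian (gram z) z p) =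
        -n * a j k + -t * gram z p j k := fun j k => by
      rw [pseudoInner_comm, inner_laplacian]
      simp only [pseudoInner_comm _ (hess z j k p)]
      rw [htrace]; ring
    rw [inner_laplacian]
    simp only [e, hdouble]
    ring
  have hscal : ∑ j : Fin n, ∑ k : Fin n, (gram z p)⁻¹ j k * ricci (gram z) j k p =
      (2 - 2 * n) * t := by
    have e : ∀ j k, ricci (gram z) j k p
        = (2 - n : ℝ) * a j k + (-t) * gram z p j k := fun j k => by
      rw [h.ricci_eq hp]
      simp only [mul_sub, Finset.sum_sub_distrib]
      rw [htrace, hcross]; ring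
    simp only [e, hdouble]
    ring
  have h1 : (n : ℝ) ≠ 0 := by exact_mod_cast hn0
  have h2 : (n : ℝ) - 1 ≠ 0 := by
    have : (2 : ℝ) ≤ n := by exact_mod_cast hn
    linarith
  -- Both terms equal `-2nt`: `n² (2 - 2n) t / (n (n - 1))` and `⟨Δz, Δz⟩`.
  rw [factor, normalizedScalar, hΔ, hscal]
  field_simp
  ring

/-! #### The Codazzi equation of the Blaschke tensor -/

/-- In the derivative of `⟨∂_i N, ∂_j z⟩`, the second derivatives of `N` and one Christoffel sum are
symmetric in `i`, `k` and drop out. What remains is `⟨∂_i N, hess_kj⟩`, in which only the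
`ξ`-component of `hess_kj` counts, as `∂_i N` is orthogonal to `z` and `N`. -/
lemma covDeriv_blaschke_sub (h : IsNullImmersion z Ω) (hn : n ≠ 0) (hp : p ∈ Ω)
    {ξ : Ambient n} (hξ : IsConformalNormal z p ξ) (i j k : Fin n) :
    covDeriv (gram z) (blaschke z) i j k p - covDeriv (gram z) (blaschke z) k j i p =
      conformalForm z ξ i p * pseudoInner 2 (hess z k j p) ξ
        - conformalForm z ξ k p * pseudoInner 2 (hess z i j p) ξ := by
  have hs := h.smooth p hp
  have hN := h.contDiffAt_nullField hp
  have hdN := hN.differentiableAt_infty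
  have hNN : ∀ i, pseudoInner 2 (pd i (nullField z) p) (nullField z p) = 0 := by
    intro i
    have := h.pd_eq_zero_of_eq_const hp (fun q hq => h.inner_nullField_self hn hq) i
    rw [pd_pseudoInner hdN hdN, pseudoInner_comm (nullField z p)] at this
    linarith
  have hNz : ∀ i, pseudoInner 2 (pd i (nullField z) p) (z p) = 0 := by
    intro i
    have := h.pd_eq_zero_of_eq_const hp (fun q hq => h.inner_nullField_lift hn hq) i
    rw [pd_pseudoInner hdN hs.differentiableAt_infty, h.inner_nullField_pd hp] at this
    linarith
  have hpdA : ∀ i j k, pd k (blaschke z i j) p =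
      pseudoInner 2 (pd k (pd i (nullField z)) p) (pd j z p)
        + pseudoInner 2 (pd i (nullField z) p) (pd k (pd j z) p) := fun i j k =>
    pd_pseudoInner (hN.pd i).differentiableAt_infty (hs.pd j).differentiableAt_infty k
  have hhess : ∀ i k j, pseudoInner 2 (pd i (nullField z) p) (pd k (pd j z) p) -
      ∑ l : Fin n, christoffel (gram z) l k j p * blaschke z i l p =
      -(conformalForm z ξ i p * -pseudoInner 2 (hess z k j p) ξ) := by
    intro i k j
    have e : pseudoInner 2 (pd i (nullField z) p) (hess z k j p) =
        pseudoInner 2 (pd i (nullField z) p) (pd k (pd j z) p) -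
          ∑ l : Fin n, christoffel (gram z) l k j p * blaschke z i l p := by
      simp only [hess, pseudoInner_sub_right, pseudoInner_sum_right, pseudoInner_smul_right]
      rfl
    rw [← e, h.eq_frame_of_orthogonal hn hp hξ (h.inner_hess_pd hp k j)]
    simp only [pseudoInner_add_right, pseudoInner_sub_right, pseudoInner_smul_right, hNN, hNz,
      conformalForm, pseudoInner_comm _ ξ, hξ.inner_self, hξ.inner_lift, hξ.inner_null]
    ring
  unfold covDeriv
  rw [hpdA, hpdA, pd_comm hN k i]
  simp only [h.christoffel_symm hp _ i k]
  linarith [hhess i k j, hhess k i j]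

/-- `Δz` is a combination of `N` and `z`. This is the trace-freeness of the second fundamental form.
-/
lemma inner_laplacian_normal (hn : n ≠ 0) {ξ : Ambient n} (hξ : IsConformalNormal z p ξ) :
    pseudoInner 2 (laplacian (gram z) z p) ξ = 0 := by
  have h1 := hξ.inner_null
  rw [pseudoInner_comm, inner_nullField, pseudoInner_comm (z p), hξ.inner_lift, mul_zero,
    sub_zero, mul_eq_zero] at h1
  exact h1.resolve_left (by simpa using hn)

end IsNullImmersion

/-- A symmetric matrix `B` that is trace-free for a positive definite form and satisfies
`B_{ij} C_k = B_{kj} C_i` for a nonzero `C` vanishes. -/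
lemma eq_zero_of_mul_eq_mul {P : Matrix (Fin n) (Fin n) ℝ} (hP : P.PosDef)
    {B : Fin n → Fin n → ℝ} (hB : ∀ i j, B i j = B j i)
    (htr : ∑ i : Fin n, ∑ j : Fin n, P i j * B i j = 0) {C : Fin n → ℝ}
    (hBC : ∀ i j k, B i j * C k = B k j * C i) {k : Fin n} (hk : C k ≠ 0) (i j : Fin n) :
    B i j = 0 := by
  -- Using the relation once in each index, via symmetry, shows that `B` has rank at most one.
  have hform : ∀ i j, B i j = B k k / C k ^ 2 * (C i * C j) := by
    intro i j
    have e1 := hBC i j k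
    have e2 := hBC j k k
    rw [hB k j] at e1
    field_simp
    calc B i j * C k ^ 2 = (B i j * C k) * C k := by ring
      _ = (B j k * C k) * C i := by rw [e1]; ring
      _ = _ := by rw [e2]; ring
  have hC : C ≠ 0 := fun h => hk (congrFun h k)
  have hpos := hP.dotProduct_mulVec_pos hC
  have hquad : ∑ i : Fin n, ∑ j : Fin n, P i j * B i j =
      B k k / C k ^ 2 * dotProduct (star C) (P.mulVec C) := by
    simp only [dotProduct, Matrix.mulVec, Finset.mul_sum, star_trivial]
    exact Finset.sum_congr rfl fun i _ => Finset.sum_congr rfl fun j _ => by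
      rw [hform i j]; ring
  rw [hquad, mul_eq_zero] at htr
  rw [hform, htr.resolve_right hpos.ne', zero_mul]

/-! ### The canonical lift -/

namespace IsNullImmersion

variable {z : Coord n → Ambient n} {Ω : Set (Coord n)} {p : Coord n}

lemma contDiffAt_canonicalLift (h : IsNullImmersion z Ω) (hp : p ∈ Ω) (hf : factor z p ≠ 0) :
    ContDiffAt ℝ ∞ (canonicalLift z) p :=
  ((h.contDiffAt_factor hp).sqrt hf).smul (h.smooth p hp)

lemma pd_canonicalLift (h : IsNullImmersion z Ω) (hp : p ∈ Ω) (hf : factor z p ≠ 0) (i : Fin n) :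
    pd i (canonicalLift z) p = Real.sqrt (factor z p) • pd i z p
      + pd i (fun q => Real.sqrt (factor z q)) p • z p :=
  pd_smul ((h.contDiffAt_factor hp).sqrt hf).differentiableAt_infty
    (h.smooth p hp).differentiableAt_infty i

/-- The derivative of `e^τ` multiplies `z`, which is null and orthogonal to `∂_i z`, so it
contributes nothing. -/
lemma gram_canonicalLift (h : IsNullImmersion z Ω) (hp : p ∈ Ω) (hf : 0 < factor z p) :
    gram (canonicalLift z) p = factor z p • gram z p := by
  ext i j
  rw [gram_apply, h.pd_canonicalLift hp hf.ne', h.pd_canonicalLift hp hf.ne', Matrix.smul_apply,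
    gram_apply, smul_eq_mul]
  simp only [pseudoInner_add_left, pseudoInner_add_right, pseudoInner_smul_left,
    pseudoInner_smul_right, h.inner_pd hp, h.null p hp, pseudoInner_comm (z p) (pd _ z p)]
  linear_combination (pseudoInner 2 (pd i z p) (pd j z p)) * Real.mul_self_sqrt hf.le

/-- The canonical lift is an immersion into the light cone where the factor is positive. -/
lemma isNullImmersion_canonicalLift (h : IsNullImmersion z Ω) :
    IsNullImmersion (canonicalLift z) (Ω ∩ {q | 0 < factor z q}) where
  isOpen := by
    rw [isOpen_iff_mem_nhds]
    rintro q ⟨hq, hf⟩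
    exact inter_mem (h.isOpen.mem_nhds hq)
      ((h.contDiffAt_factor hq).continuousAt.eventually_mem (Ioi_mem_nhds hf))
  smooth q hq := h.contDiffAt_canonicalLift hq.1 hq.2.ne'
  null q hq := by
    simp [canonicalLift, pseudoInner_smul_left, pseudoInner_smul_right,
      h.null q hq.1]
  det_ne_zero q hq := by
    rw [h.gram_canonicalLift hq.1 hq.2, Matrix.det_smul]
    exact mul_ne_zero (pow_ne_zero _ hq.2.ne') (h.det_ne_zero q hq.1)

/-- The second fundamental forms of the canonical lift and of the given lift are proportional. -/
lemma inner_pd_pd_canonicalLift (h : IsNullImmersion z Ω) (hp : p ∈ Ω) (hf : 0 < factor z p)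
    {ξ : Ambient n} (hξ : pseudoInner 2 ξ (z p) = 0) (hξt : ∀ i, pseudoInner 2 ξ (pd i z p) = 0)
    (i j : Fin n) :
    pseudoInner 2 (pd i (pd j (canonicalLift z)) p) ξ =
      Real.sqrt (factor z p) * pseudoInner 2 (pd i (pd j z) p) ξ := by
  have hs := h.smooth p hp
  have hρ := (h.contDiffAt_factor hp).sqrt hf.ne'
  have e : pd j (canonicalLift z) =ᶠ[𝓝 p]
      fun q => Real.sqrt (factor z q) • pd j z q
        + pd j (fun q => Real.sqrt (factor z q)) q • z q := by
    filter_upwards [h.isOpen.mem_nhds hp,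
      (h.contDiffAt_factor hp).continuousAt.eventually_ne hf.ne'] with q hq hfq
    exact h.pd_canonicalLift hq hfq j
  rw [pd_congr e, pd_add (hρ.differentiableAt_infty.fun_smul (hs.pd j).differentiableAt_infty)
      ((hρ.pd j).differentiableAt_infty.fun_smul hs.differentiableAt_infty),
    pd_smul hρ.differentiableAt_infty (hs.pd j).differentiableAt_infty,
    pd_smul (hρ.pd j).differentiableAt_infty hs.differentiableAt_infty]
  simp only [pseudoInner_comm _ ξ, pseudoInner_add_right, pseudoInner_smul_right, hξ, hξt]
  ring

end IsNullImmersion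

/-- Serves the degenerate case of a negative factor, where `Real.sqrt` returns `0`. -/
lemma nullField_eq_zero {Y : Coord n → Ambient n} {p : Coord n} (h : Y =ᶠ[𝓝 p] fun _ => 0) :
    nullField Y p = 0 := by
  have h1 : ∀ j, pd j Y =ᶠ[𝓝 p] fun _ => 0 := fun j =>
    (eventuallyEq_pd h j).trans (Eventually.of_forall fun q => by simp)
  have h2 : ∀ i j, pd i (pd j Y) p = 0 := fun i j => by rw [pd_congr (h1 j), pd_const]
  have h3 : ∀ j, pd j Y p = 0 := fun j => (h1 j).self_of_nhds
  have h4 : Y p = 0 := h.self_of_nhds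
  simp [nullField, laplacian, h2, h3, h4]

/-- The conformal form vanishes at a point where the Blaschke tensor is parallel. -/
theorem IsNullImmersion.conformalForm_eq_zero {z : Coord n → Ambient n} {Ω : Set (Coord n)}
    {p : Coord n} (h : IsNullImmersion z Ω) (hn : 2 ≤ n) (hp : p ∈ Ω) (hpos : (gram z p).PosDef)
    (hf : factor z p ≠ 0)
    (hpar : ∀ i j k, covDeriv (gram (canonicalLift z)) (blaschke (canonicalLift z)) i j k p = 0)
    {ξ : Ambient n} (hξ : IsConformalNormal (canonicalLift z) p ξ) (k : Fin n) :
    conformalForm (canonicalLift z) ξ k p = 0 := by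
  have hn0 : n ≠ 0 := by omega
  -- Non-negativity of the factor is not needed: near a point where it is negative, `canonicalLift`
  -- is identically zero by the convention for `Real.sqrt`, and so is the conformal form.
  rcases hf.lt_or_gt with hneg | hf
  · have hY : canonicalLift z =ᶠ[𝓝 p] fun _ => 0 := by
      filter_upwards [(h.contDiffAt_factor hp).continuousAt.eventually_mem (Iio_mem_nhds hneg)]
        with q hq
      simp [canonicalLift, Real.sqrt_eq_zero_of_nonpos (le_of_lt hq)]
    have hN : nullField (canonicalLift z) =ᶠ[𝓝 p] fun _ => 0 :=
      hY.eventuallyEq_nhds.mono fun q hq => nullField_eq_zero hq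
    simp [conformalForm, pd_congr hN]
  have hY := h.isNullImmersion_canonicalLift
  have hpY : p ∈ Ω ∩ {q | 0 < factor z q} := ⟨hp, hf⟩
  by_contra hk
  have hρ : Real.sqrt (factor z p) ≠ 0 := (Real.sqrt_pos.2 hf).ne'
  have hξz : pseudoInner 2 ξ (z p) = 0 := by
    have := hξ.inner_lift
    rw [canonicalLift, pseudoInner_smul_right] at this
    exact (mul_eq_zero.1 this).resolve_left hρ
  have hξt : ∀ i, pseudoInner 2 ξ (pd i z p) = 0 := by
    intro i
    have := hξ.inner_tangent i
    rw [h.pd_canonicalLift hp hf.ne', pseudoInner_add_right, pseudoInner_smul_right,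
      pseudoInner_smul_right, hξz, mul_zero, add_zero] at this
    exact (mul_eq_zero.1 this).resolve_left hρ
  have hposY : (gram (canonicalLift z) p)⁻¹.PosDef := by
    rw [h.gram_canonicalLift hp hf]
    exact (hpos.smul hf).inv
  -- Parallelism kills the left side of the Codazzi equation, and `hk` supplies the nonzero
  -- component of `C`.
  have hB : ∀ i j, pseudoInner 2 (hess (canonicalLift z) i j p) ξ = 0 := by
    refine eq_zero_of_mul_eq_mul hposY (fun i j => by rw [hY.hess_symm hpY]) ?_
      (C := fun i => conformalForm (canonicalLift z) ξ i p) (fun i j k => ?_) hk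
    · rw [← IsNullImmersion.inner_laplacian, IsNullImmersion.inner_laplacian_normal hn0 hξ]
    · have := hY.covDeriv_blaschke_sub hn0 hpY hξ i j k
      rw [hpar, hpar] at this
      linarith
  refine hf.ne' (h.factor_eq_zero hn hp hξ.inner_self hξz hξt fun i j => ?_)
  have := hB i j
  rw [IsNullImmersion.inner_hess_of_orthogonal
    (fun m => by rw [pseudoInner_comm, hξ.inner_tangent]),
    h.inner_pd_pd_canonicalLift hp hf hξz hξt] at this
  exact (mul_eq_zero.1 this).resolve_left hρ

/-! ### Local lifts in charts -/

section Hypersurface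

variable {M : Type*} [TopologicalSpace M] [ChartedSpace (EuclideanSpace ℝ (Fin n)) M]

/-- `Quadric` tests only the chosen representative, of which `y m` is a nonzero multiple. -/
lemma IsLocalLift.null {x : M → Quadric (n + 1) 1} {U : Set M} {y : M → Ambient n}
    (h : IsLocalLift x U y) {m : M} (hm : m ∈ U) : pseudoInner 2 (y m) (y m) = 0 := by
  obtain ⟨h0, hx⟩ := h.lifts m hm
  have hq : pseudoInner 2 (x m).1.rep (x m).1.rep = 0 := (x m).2
  obtain ⟨a, ha⟩ := Projectivization.exists_smul_eq_mk_rep ℝ (y m) h0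
  rw [hx, ← ha, Units.smul_def, pseudoInner_smul_left, pseudoInner_smul_right] at hq
  simpa using hq

/-- The coordinate expression of a local lift of a space-like hypersurface is an immersion into
the light cone. -/
lemma IsLocalLift.isNullImmersion [IsManifold (𝓡 n) ∞ M] {x : M → Quadric (n + 1) 1}
    (hx : IsRegularSpacelike x) {U : Set M} {y : M → Ambient n} (h : IsLocalLift x U y)
    {e : OpenPartialHomeomorph M (EuclideanSpace ℝ (Fin n))}
    (he : e ∈ IsManifold.maximalAtlas (𝓡 n) ∞ M) :
    IsNullImmersion (fun q => y (e.symm q)) (e.target ∩ e.symm ⁻¹' U) where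
  isOpen := e.isOpen_inter_preimage_symm h.isOpen
  smooth q hq := by
    have h1 : ContMDiffAt (𝓡 n) 𝓘(ℝ, Ambient n) ∞ y (e.symm q) :=
      h.smooth.contMDiffAt (h.isOpen.mem_nhds hq.2)
    have h2 : ContMDiffAt (𝓡 n) (𝓡 n) ∞ e.symm q :=
      (contMDiffOn_symm_of_mem_maximalAtlas he).contMDiffAt (e.open_target.mem_nhds hq.1)
    exact contMDiffAt_iff_contDiffAt.1 (h1.comp q h2)
  null q hq := h.null hq.2
  det_ne_zero q hq := by
    have := hx.spacelike U y h e he (e.symm q) hq.2 (e.map_target hq.1)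
    rw [e.right_inv hq.1] at this
    exact this.det_pos.ne'

end Hypersurface

end ConformalSpace
end

theorem lemma2p1 {n : ℕ} (hn : 2 ≤ n) {M : Type*} [TopologicalSpace M]
    [ChartedSpace (EuclideanSpace ℝ (Fin n)) M] [IsManifold (𝓡 n) ∞ M]
    (x : M → ConformalSpace.Quadric (n + 1) 1)
    (hx : ConformalSpace.IsRegularSpacelike x)
    (hA : ConformalSpace.IsBlaschkeParallel x) :
    ConformalSpace.ConformalFormVanishes x := by
  intro U y hy e he m hmU hme ξ hξ i
  exact (hy.isNullImmersion hx he).conformalForm_eq_zero hn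
    ⟨e.map_source hme, by rwa [Set.mem_preimage, e.left_inv hme]⟩
    (hx.spacelike U y hy e he m hmU hme) (hx.regular U y hy e he m hmU hme)
    (hA U y hy e he m hmU hme) hξ i
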